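/- **Theorem (optimality of threshold policies for secretaries with samples).** Let $n \ge 1$ and $k \ge 0$ be integers. An adversary writes down $n+k$ distinct real numbers. A uniformly random subset of $k$ of them is revealed as samples, and the remaining $n$ numbers (the candidates) then arrive one by one in uniformly random order. Write $i \succeq j$ if the $i$-th candidate is at least as large as the $j$-th one, let the rank $r_i \in \{1,\dots,n\}$ be the number of candidates $j$ with $j \preceq i$ (so $r_i = n$ means that $i$ is the best candidate), and let the signal $s_i \in \mathcal S = \{0,\dots,k\}$ be the number of samples that are smaller than the $i$-th candidate. When candidate $i$ arrives, the information available is $(\preceq_{1..i}, s_1, \dots, s_i)$: all comparisons between the first $i$ candidates, and their signals. A *policy* is a map that assigns to each period $i$ and each possible value of the available information a probability in $[0,1]$ of stopping at candidate $i$, given that no earlier candidate was picked. The policy wins if it picks the candidate with $r_i = n$. Let $T_i$ be the event that $i \succeq j$ for all $j < i$. A policy is a *threshold policy* if there is a function $t : \mathcal S \to \{1,\dots,n\}$ such that the policy stops at the time $$\tau = \min\{\, i : T_i \text{ holds and } i \ge t(s_i) \,\}.$$ Then, for every $n \ge 1$ and every $k \ge 0$, the optimal policy is a threshold policy: there is a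 threshold policy (depending only on $n$ and $k$) whose winning probability, for every choice of $n+k$ distinct numbers by the adversary, is at least that of every other policy. -/

import Mathlib

open scoped BigOperators

namespace SecretarySamples

noncomputable section

/-- An arrangement of the `n + k` numbers written down by the adversary: `σ (Sum.inl b)` is the
position of the `b`-th sample and `σ (Sum.inr i)` is the position of the `i`-th arriving candidate.
For a uniformly random arrangement the set of samples is a uniformly random `k`-subset, and given
this subset the other `n` numbers arrive in uniformly random order. -/
abbrev Arrangement (n k : ℕ) : Type := (Fin k ⊕ Fin n) ≃ Fin (n + k)

variable {n k : ℕ}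

/-- The value of the `b`-th sample. -/
def sampleValue (x : Fin (n + k) → ℝ) (σ : Arrangement n k) (b : Fin k) : ℝ :=
  x (σ (Sum.inl b))

/-- The value of the `i`-th arriving candidate. -/
def value (x : Fin (n + k) → ℝ) (σ : Arrangement n k) (i : Fin n) : ℝ :=
  x (σ (Sum.inr i))

/-- The rank of the `i`-th candidate among the `n` candidates: rank `n` is the best one, rank `1`
the worst one. -/
def rank (x : Fin (n + k) → ℝ) (σ : Arrangement n k) (i : Fin n) : ℕ :=
  (Finset.univ.filter fun j : Fin n => value x σ j ≤ value x σ i).card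

/-- The signal of the `i`-th candidate: the number of samples that are worse than it. -/
def signal (x : Fin (n + k) → ℝ) (σ : Arrangement n k) (i : Fin n) : Fin (k + 1) :=
  ⟨(Finset.univ.filter fun b : Fin k => sampleValue x σ b < value x σ i).card,
    Nat.lt_succ_of_le ((Finset.card_le_univ _).trans_eq (Fintype.card_fin k))⟩

/-- What the algorithm knows once `m` candidates have arrived: all comparisons between these
candidates (`le a b` means that candidate `b` is at least as good as candidate `a`), and all their
signals. -/
structure History (k m : ℕ) where
  le : Fin m → Fin m → Prop
  signal : Fin m → Fin (k + 1)

/-- The information that is available when candidate `i` has arrived (candidates are numbered from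
`0`, so `i + 1` candidates have been seen, and `i` is the last of them). -/
def history (x : Fin (n + k) → ℝ) (σ : Arrangement n k) (i : Fin n) :
    History k (i.val + 1) where
  le a b := value x σ (Fin.castLE i.isLt a) ≤ value x σ (Fin.castLE i.isLt b)
  signal a := SecretarySamples.signal x σ (Fin.castLE i.isLt a)

/-- The event that the last candidate seen is at least as good as all candidates before it. -/
def History.BestSoFar {m : ℕ} (h : History k (m + 1)) : Prop :=
  ∀ a : Fin (m + 1), h.le a (Fin.last m)

/-- A (randomized, history-dependent) policy: for each period a map from the available information
to the probability of stopping with the current candidate, if no earlier one has been picked. -/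
structure Policy (n k : ℕ) where
  stopProb : (i : Fin n) → History k (i.val + 1) → ℝ
  nonneg : ∀ i h, 0 ≤ stopProb i h
  le_one : ∀ i h, stopProb i h ≤ 1

/-- The probability, over the randomness of the policy, that candidate `i` is picked in a given
arrangement: the policy passes on all earlier candidates and stops at `i`. -/
def Policy.pickProb (π : Policy n k) (x : Fin (n + k) → ℝ) (σ : Arrangement n k) (i : Fin n) : ℝ :=
  (∏ j ∈ Finset.univ.filter (fun j : Fin n => j < i), (1 - π.stopProb j (history x σ j))) *
    π.stopProb i (history x σ i)

/-- The probability that the policy picks the best candidate, over a uniformly random arrangement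
and the randomness of the policy. -/
def Policy.winProb (π : Policy n k) (x : Fin (n + k) → ℝ) : ℝ :=
  𝔼 σ : Arrangement n k, ∑ i : Fin n, if rank x σ i = n then π.pickProb x σ i else 0

/-- A policy is optimal if it maximizes the probability of picking the best candidate among all
policies, whatever the (distinct) numbers written down by the adversary. -/
def Policy.IsOptimal (π : Policy n k) : Prop :=
  ∀ x : Fin (n + k) → ℝ, Function.Injective x → ∀ π' : Policy n k, π'.winProb x ≤ π.winProb x

open Classical in
/-- The policy that stops at the first candidate `i` that is best so far and satisfies `t s ≤ i`,
where `s` is the signal of `i`. -/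
def thresholdPolicy (t : Fin (k + 1) → Fin n) : Policy n k where
  stopProb i h := if h.BestSoFar ∧ t (h.signal (Fin.last i.val)) ≤ i then 1 else 0
  nonneg i h := by split_ifs <;> norm_num
  le_one i h := by split_ifs <;> norm_num

/-- A policy is a threshold policy if it is given by some threshold function from signals to
periods. -/
def Policy.IsThreshold (π : Policy n k) : Prop :=
  ∃ t : Fin (k + 1) → Fin n, π = thresholdPolicy t

end

end SecretarySamples

/-!
The process is a Markov chain in the state `(m, b)`, where `m` candidates have arrived and `b`
samples are better than all of them. Let `u` be the number of known items (samples and earlier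
candidates) that are better than the next candidate. Given the order of the known items, `u` is
uniform on `{0, …, k + m}` (`sum_apply_numAbove`): exchanging the newcomer with an adjacent item
moves its rank by one and keeps the order of the others. The newcomer is a record exactly if
`u ≤ b`, and then `u` is the next value of `b`; otherwise `b` does not change (`sum_mul_step`).

Hence the probability `stopValue` of winning by stopping at a record, and the optimal probability
`contValue` of winning after passing, depend on the state only and satisfy backward recursions.
Weighting `contValue` with the probability that a policy gets that far gives a potential whose
decrease in each period is the probability of winning there plus a loss. The losses are nonnegative
for every policy, and vanish for a policy that stops at exactly those records where `stopValue` is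
at least `contValue` (`sum_pickProb_eq`).

It remains to see that these records are given by a threshold for each signal; a record with signal
`s` has `b = k - s`. If passing is strictly better than stopping in state `(m + 1, b)`, then this
holds in `(m, b)` too (`stopValue_lt_contValue`): stopping in `(m, b)` wins only if the next
candidate is not a record, which leads to `(m + 1, b)`, and continuing from there is strictly
better. So the periods where stopping is optimal form an up-set, which contains the last period.

Conditional expectations do not appear: all identities are between sums over arrangements, with a
weight that depends only on the order of the known items (`DependsOnOrder`).
-/

namespace SecretarySamples

open Finset

/-! ### The relative rank of a newcomer is uniform -/

section RelativeRank

variable {ι α : Type*}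

/-- Two assignments of the values `x` to the items compare the items of `J` in the same way. -/
def SameOrder (x : α → ℝ) (J : Finset ι) (σ τ : ι ≃ α) : Prop :=
  ∀ p ∈ J, ∀ q ∈ J, (x (σ p) ≤ x (σ q) ↔ x (τ p) ≤ x (τ q))

/-- A function of the assignment that is determined by the comparisons between the items of `J`.
This plays the part of measurability with respect to the information on `J`. -/
def DependsOnOrder {β : Type*} (x : α → ℝ) (J : Finset ι) (f : (ι ≃ α) → β) : Prop :=
  ∀ σ τ, SameOrder x J σ τ → f σ = f τ

/-- The number of items of `J` that are better than item `a`. -/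
noncomputable def numAbove (x : α → ℝ) (J : Finset ι) (a : ι) (σ : ι ≃ α) : ℕ :=
  #{p ∈ J | x (σ a) < x (σ p)}

/-- Item `w` is the worst item of `J` that is better than `a`. -/
def IsNext (x : α → ℝ) (J : Finset ι) (a w : ι) (σ : ι ≃ α) : Prop :=
  x (σ a) < x (σ w) ∧ ∀ p ∈ J, x (σ a) < x (σ p) → x (σ w) ≤ x (σ p)

/-- Item `w` is the best item of `J` that is worse than `a`. -/
def IsPrev (x : α → ℝ) (J : Finset ι) (a w : ι) (σ : ι ≃ α) : Prop :=
  x (σ w) < x (σ a) ∧ ∀ p ∈ J, x (σ p) < x (σ a) → x (σ p) ≤ x (σ w)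

variable {x : α → ℝ} {J : Finset ι} {a w : ι} {σ τ : ι ≃ α}

lemma SameOrder.lt_iff (h : SameOrder x J σ τ) {p q : ι} (hp : p ∈ J) (hq : q ∈ J) :
    x (σ p) < x (σ q) ↔ x (τ p) < x (τ q) := by
  rw [← not_le, ← not_le, h q hq p hp]

lemma SameOrder.mono {J' : Finset ι} (hJ : J ⊆ J') (h : SameOrder x J' σ τ) :
    SameOrder x J σ τ :=
  fun p hp q hq => h p (hJ hp) q (hJ hq)

lemma numAbove_le_card : numAbove x J a σ ≤ #J := card_filter_le _ _

lemma exists_isNext (h : 0 < numAbove x J a σ) : ∃ w ∈ J, IsNext x J a w σ := by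
  obtain ⟨w, hw, hmin⟩ := exists_min_image _ (fun p => x (σ p)) (card_pos.1 h)
  rw [mem_filter] at hw
  exact ⟨w, hw.1, hw.2, fun p hp hap => hmin p (mem_filter.2 ⟨hp, hap⟩)⟩

lemma exists_isPrev (hx : x.Injective) (ha : a ∉ J) (h : numAbove x J a σ < #J) :
    ∃ w ∈ J, IsPrev x J a w σ := by
  have hne : ({p ∈ J | x (σ p) < x (σ a)} : Finset ι).Nonempty := by
    by_contra hemp
    rw [not_nonempty_iff_eq_empty, filter_eq_empty_iff] at hemp
    refine h.ne (congrArg card (filter_true_of_mem fun p hp => ?_))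
    refine lt_of_le_of_ne (not_lt.1 (hemp hp)) fun he => ha ?_
    rwa [σ.injective (hx he)]
  obtain ⟨w, hw, hmax⟩ := exists_max_image _ (fun p => x (σ p)) hne
  rw [mem_filter] at hw
  exact ⟨w, hw.1, hw.2, fun p hp hpa => hmax p (mem_filter.2 ⟨hp, hpa⟩)⟩

lemma IsNext.unique (hx : x.Injective) {w' : ι} (hw : w ∈ J) (hw' : w' ∈ J)
    (h : IsNext x J a w σ) (h' : IsNext x J a w' σ) : w = w' :=
  σ.injective (hx (le_antisymm (h.2 w' hw' h'.1) (h'.2 w hw h.1)))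

lemma IsPrev.unique (hx : x.Injective) {w' : ι} (hw : w ∈ J) (hw' : w' ∈ J)
    (h : IsPrev x J a w σ) (h' : IsPrev x J a w' σ) : w = w' :=
  σ.injective (hx (le_antisymm (h'.2 w hw h.1) (h.2 w' hw' h'.1)))

variable [DecidableEq ι]

lemma swap_trans_apply_of_mem (ha : a ∉ J) {p : ι} (hp : p ∈ J) (hpw : p ≠ w) :
    ((Equiv.swap a w).trans σ) p = σ p := by
  rw [Equiv.trans_apply, Equiv.swap_apply_of_ne_of_ne (ne_of_mem_of_not_mem hp ha) hpw]

lemma isPrev_swap_iff (ha : a ∉ J) :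
    IsPrev x J a w ((Equiv.swap a w).trans σ) ↔ IsNext x J a w σ := by
  have h1 : ((Equiv.swap a w).trans σ) a = σ w := by simp
  have h2 : ((Equiv.swap a w).trans σ) w = σ a := by simp
  unfold IsPrev IsNext
  rw [h1, h2]
  refine and_congr_right fun haw => forall₂_congr fun p hp => ?_
  rcases eq_or_ne p w with rfl | hpw
  · rw [h2]; simp
  · rw [swap_trans_apply_of_mem ha hp hpw, ← not_le, ← not_le, not_imp_comm]

lemma sameOrder_swap (hx : x.Injective) (ha : a ∉ J) (h : IsNext x J a w σ) :
    SameOrder x J σ ((Equiv.swap a w).trans σ) := by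
  have h2 : ((Equiv.swap a w).trans σ) w = σ a := by simp
  -- no item of `J` lies between `a` and `w`
  have key : ∀ p ∈ J, p ≠ w → (x (σ p) ≤ x (σ w) ↔ x (σ p) ≤ x (σ a)) ∧
      (x (σ w) ≤ x (σ p) ↔ x (σ a) ≤ x (σ p)) := by
    intro p hp hpw
    have hne : x (σ p) ≠ x (σ a) := fun h => ha (σ.injective (hx h) ▸ hp)
    have hne' : x (σ p) ≠ x (σ w) := fun h => hpw (σ.injective (hx h))
    refine ⟨⟨fun hle => ?_, fun hle => hle.trans h.1.le⟩, fun hle => h.1.le.trans hle,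
      fun hle => h.2 p hp (lt_of_le_of_ne hle hne.symm)⟩
    by_contra hlt
    exact hne' (le_antisymm hle (h.2 p hp (not_le.1 hlt)))
  intro p hp q hq
  rcases eq_or_ne p w with hpw | hpw <;> rcases eq_or_ne q w with hqw | hqw
  · simp [hpw, hqw]
  · rw [hpw, h2, swap_trans_apply_of_mem ha hq hqw, (key q hq hqw).2]
  · rw [hqw, h2, swap_trans_apply_of_mem ha hp hpw, (key p hp hpw).1]
  · rw [swap_trans_apply_of_mem ha hp hpw, swap_trans_apply_of_mem ha hq hqw]

lemma numAbove_swap (ha : a ∉ J) (hx : x.Injective) (hw : w ∈ J) (h : IsNext x J a w σ) :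
    numAbove x J a ((Equiv.swap a w).trans σ) + 1 = numAbove x J a σ := by
  have h1 : ((Equiv.swap a w).trans σ) a = σ w := by simp
  have h2 : ((Equiv.swap a w).trans σ) w = σ a := by simp
  unfold numAbove
  rw [h1, ← card_erase_add_one (s := {p ∈ J | x (σ a) < x (σ p)}) (a := w) (by simp [hw, h.1])]
  congr 2
  ext p
  rw [mem_erase, mem_filter, mem_filter]
  rcases eq_or_ne p w with rfl | hpw
  · rw [h2]; simp [h.1.le]
  · have hne : x (σ w) ≠ x (σ p) := fun h => hpw (σ.injective (hx h)).symm
    refine ⟨fun ⟨hp, hlt⟩ => ?_, fun ⟨_, hp, hlt⟩ => ?_⟩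
    · rw [swap_trans_apply_of_mem ha hp hpw] at hlt
      exact ⟨hpw, hp, h.1.trans hlt⟩
    · rw [swap_trans_apply_of_mem ha hp hpw]
      exact ⟨hp, lt_of_le_of_ne (h.2 p hp hlt) hne⟩

variable [Fintype ι] [Fintype α] [DecidableEq α]

open scoped Classical in
/-- Exchanging the newcomer with the next better item is a bijection, which keeps the order of the
old items, from the assignments where `r + 1` old items are better than the newcomer to those where
`r` are. -/
lemma sum_numAbove_succ (hx : x.Injective) (ha : a ∉ J) {f : (ι ≃ α) → ℝ}
    (hf : DependsOnOrder x J f) {r : ℕ} (hr : r < #J) :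
    ∑ σ, (if numAbove x J a σ = r + 1 then f σ else 0) =
      ∑ σ, (if numAbove x J a σ = r then f σ else 0) := by
  have hL : ∀ σ : ι ≃ α, (if numAbove x J a σ = r + 1 then f σ else 0) =
      ∑ w ∈ J, if numAbove x J a σ = r + 1 ∧ IsNext x J a w σ then f σ else 0 := by
    intro σ
    by_cases hu : numAbove x J a σ = r + 1
    · obtain ⟨w, hw, hn⟩ := exists_isNext (x := x) (J := J) (a := a) (σ := σ) (by omega)
      rw [sum_eq_single_of_mem w hw fun w' hw' hne =>
        if_neg fun h => hne (h.2.unique hx hw' hw hn)]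
      simp [hu, hn]
    · simp [hu]
  have hR : ∀ σ : ι ≃ α, (if numAbove x J a σ = r then f σ else 0) =
      ∑ w ∈ J, if numAbove x J a σ = r ∧ IsPrev x J a w σ then f σ else 0 := by
    intro σ
    by_cases hu : numAbove x J a σ = r
    · obtain ⟨w, hw, hn⟩ := exists_isPrev (σ := σ) hx ha (by omega)
      rw [sum_eq_single_of_mem w hw fun w' hw' hne =>
        if_neg fun h => hne (h.2.unique hx hw' hw hn)]
      simp [hu, hn]
    · simp [hu]
  rw [sum_congr rfl fun σ _ => hL σ, sum_congr rfl fun σ _ => hR σ, sum_comm, sum_comm (s := univ)]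
  refine sum_congr rfl fun w hw => ?_
  have hinv : Function.Involutive fun σ : ι ≃ α => (Equiv.swap a w).trans σ := fun σ => by
    ext p; simp
  refine Fintype.sum_bijective _ hinv.bijective _ _ fun σ => ?_
  rw [isPrev_swap_iff ha]
  by_cases hn : IsNext x J a w σ
  · simp only [hn, and_true, ← numAbove_swap ha hx hw hn, Nat.add_right_cancel_iff,
      hf _ _ (sameOrder_swap hx ha hn)]
  · simp [hn]

/-- The number of old items that are better than the newcomer is uniform on `{0, …, #J}` and
independent of the order of the old items. -/
lemma sum_apply_numAbove (hx : x.Injective) (ha : a ∉ J) {F : ℕ → (ι ≃ α) → ℝ}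
    (hF : ∀ r, DependsOnOrder x J (F r)) :
    ∑ σ, F (numAbove x J a σ) σ = ∑ σ, (∑ r ∈ range (#J + 1), F r σ) / (#J + 1) := by
  have hconst : ∀ s r, r ≤ #J → ∑ σ, (if numAbove x J a σ = r then F s σ else 0) =
      ∑ σ, (if numAbove x J a σ = 0 then F s σ else 0) := by
    intro s r
    induction r with
    | zero => exact fun _ => rfl
    | succ r ih => exact fun hr => (sum_numAbove_succ hx ha (hF s) hr).trans (ih (by omega))
  have hsplit : ∀ σ : ι ≃ α, ∀ g : ℕ → ℝ, g (numAbove x J a σ) =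
      ∑ r ∈ range (#J + 1), if numAbove x J a σ = r then g r else 0 := by
    intro σ g
    rw [sum_ite_eq, if_pos (mem_range.2 (Nat.lt_succ_of_le numAbove_le_card))]
  have htotal : ∀ s, ∑ σ, F s σ =
      (#J + 1) * ∑ σ, (if numAbove x J a σ = 0 then F s σ else 0) := by
    intro s
    rw [sum_congr rfl fun σ _ => hsplit σ fun _ => F s σ, sum_comm,
      sum_congr rfl fun r hr => hconst s r (Nat.le_of_lt_succ (mem_range.1 hr))]
    simp
  have hpos : (#J + 1 : ℝ) ≠ 0 := by positivity
  rw [← sum_div, sum_comm, sum_congr rfl fun s _ => htotal s, ← mul_sum,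
    mul_div_cancel_left₀ _ hpos, sum_congr rfl fun σ _ => hsplit σ fun r => F r σ, sum_comm]
  exact sum_congr rfl fun r hr => hconst r r (Nat.le_of_lt_succ (mem_range.1 hr))

end RelativeRank

/-! ### The state of the process -/

section State

variable {n k : ℕ}

/-- The items known after `m` arrivals: all samples and the first `m` candidates. -/
def seen (n k m : ℕ) : Finset (Fin k ⊕ Fin n) :=
  univ.disjSum {i : Fin n | i.val < m}

@[simp] lemma inl_mem_seen {m : ℕ} (b : Fin k) : Sum.inl b ∈ seen n k m := by simp [seen]

@[simp] lemma inr_mem_seen {m : ℕ} {i : Fin n} : Sum.inr i ∈ seen n k m ↔ i.val < m := by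
  simp [seen]

lemma card_seen {m : ℕ} (hm : m ≤ n) : #(seen n k m) = k + m := by
  simp [seen, Fin.card_filter_val_lt, hm]

lemma seen_subset {m m' : ℕ} (h : m ≤ m') : seen n k m ⊆ seen n k m' := by
  rintro (b | i) hi
  · simp
  · rw [inr_mem_seen] at *; omega

/-- The number of samples that are better than each of the first `m` candidates. -/
noncomputable def samplesAbove (x : Fin (n + k) → ℝ) (m : ℕ) (σ : Arrangement n k) : ℕ :=
  #{b : Fin k | ∀ i : Fin n, i.val < m → value x σ i < sampleValue x σ b}

/-- Candidate `i` is at least as good as all candidates before it. -/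
def IsRecord (x : Fin (n + k) → ℝ) (i : Fin n) (σ : Arrangement n k) : Prop :=
  ∀ j < i, value x σ j ≤ value x σ i

variable {x : Fin (n + k) → ℝ} {σ : Arrangement n k}

lemma samplesAbove_le (m : ℕ) : samplesAbove x m σ ≤ k :=
  (card_filter_le _ _).trans_eq (by simp)

lemma samplesAbove_zero : samplesAbove x 0 σ = k := by simp [samplesAbove]

lemma dependsOnOrder_samplesAbove (x : Fin (n + k) → ℝ) (m : ℕ) :
    DependsOnOrder x (seen n k m) (samplesAbove x m) := by
  intro σ τ h
  refine congrArg card (filter_congr fun b _ => forall₂_congr fun i hi => ?_)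
  exact h.lt_iff (inr_mem_seen.2 hi) (inl_mem_seen b)

lemma dependsOnOrder_isRecord (x : Fin (n + k) → ℝ) (i : Fin n) :
    DependsOnOrder x (seen n k (i.val + 1)) (IsRecord x i) := by
  intro σ τ h
  refine propext (forall₂_congr fun j hj => h _ (inr_mem_seen.2 ?_) _ (inr_mem_seen.2 ?_)) <;>
    omega

lemma dependsOnOrder_history (x : Fin (n + k) → ℝ) (i : Fin n) :
    DependsOnOrder x (seen n k (i.val + 1)) fun σ => history x σ i := by
  intro σ τ h
  have hmem : ∀ a : Fin (i.val + 1), Sum.inr (Fin.castLE i.isLt a) ∈ seen n k (i.val + 1) :=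
    fun a => inr_mem_seen.2 (by simpa using a.isLt)
  have hle : (history x σ i).le = (history x τ i).le := by
    funext a b
    exact propext (h _ (hmem a) _ (hmem b))
  have hsig : (history x σ i).signal = (history x τ i).signal := by
    funext a
    refine Fin.ext ?_
    change #{b : Fin k | sampleValue x σ b < value x σ (Fin.castLE i.isLt a)} =
      #{b : Fin k | sampleValue x τ b < value x τ (Fin.castLE i.isLt a)}
    exact congrArg card (filter_congr fun b _ => h.lt_iff (inl_mem_seen b) (hmem a))
  exact congrArg₂ History.mk hle hsig

/-- The items better than a record are the samples better than it. -/
lemma samplesAbove_succ_of_isRecord (i : Fin n) (h : IsRecord x i σ) :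
    samplesAbove x (i.val + 1) σ = numAbove x (seen n k i) (Sum.inr i) σ := by
  unfold samplesAbove numAbove
  rw [← card_map Function.Embedding.inl]
  congr 1
  ext p
  rcases p with b | j
  · simp only [mem_map, mem_filter, mem_univ, true_and, Function.Embedding.inl_apply,
      Sum.inl.injEq, exists_eq_right, inl_mem_seen]
    refine ⟨fun hb => hb i (by omega), fun hb j hj => lt_of_le_of_lt ?_ hb⟩
    rcases eq_or_ne j i with rfl | hne
    · exact le_rfl
    · exact h j (lt_of_le_of_ne (Fin.le_def.2 (by omega)) hne)
  · simp only [mem_map, mem_filter, inr_mem_seen, Function.Embedding.inl_apply, reduceCtorEq,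
      and_false, exists_false, false_iff, not_and, not_lt]
    exact fun hj => h j hj

lemma samplesAbove_succ_le (m : ℕ) : samplesAbove x (m + 1) σ ≤ samplesAbove x m σ :=
  card_le_card (monotone_filter_right _ fun _ _ hb i hi => hb i (by omega))

/-- A candidate that is not a record leaves the best candidate, and hence the samples above it,
unchanged. -/
lemma samplesAbove_succ_of_not_isRecord (i : Fin n) (h : ¬ IsRecord x i σ) :
    samplesAbove x (i.val + 1) σ = samplesAbove x i σ := by
  unfold IsRecord at h
  push Not at h
  obtain ⟨c, hci, hc⟩ := h
  refine congrArg card (filter_congr fun b _ => ⟨fun hb j hj => hb j (by omega), fun hb j hj => ?_⟩)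
  rcases eq_or_ne j i with rfl | hne
  · exact hc.trans (hb c hci)
  · exact hb j (by omega)

lemma isRecord_iff (i : Fin n) :
    IsRecord x i σ ↔ numAbove x (seen n k i) (Sum.inr i) σ ≤ samplesAbove x i σ := by
  refine ⟨fun h => (samplesAbove_succ_of_isRecord i h).symm.trans_le (samplesAbove_succ_le _),
    fun h => ?_⟩
  by_contra hnot
  unfold IsRecord at hnot
  push Not at hnot
  obtain ⟨c, hci, hc⟩ := hnot
  -- an earlier candidate and all samples above the earlier candidates are better than `i`
  refine absurd h (not_le.2 ?_)
  have hcard : samplesAbove x i σ + 1 = #(({b : Fin k | ∀ j : Fin n, j.val < i.val →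
      value x σ j < sampleValue x σ b} : Finset (Fin k)).disjSum {c}) := by
    rw [card_disjSum, card_singleton]; rfl
  refine Nat.lt_of_succ_le (hcard.trans_le (card_le_card ?_))
  rintro (b | j) hp
  · simp only [inl_mem_disjSum, mem_filter, mem_univ, true_and] at hp
    exact mem_filter.2 ⟨inl_mem_seen b, hc.trans (hp c hci)⟩
  · simp only [inr_mem_disjSum, mem_singleton] at hp
    subst hp
    exact mem_filter.2 ⟨inr_mem_seen.2 hci, hc⟩

/-- The number of known items above the next candidate is uniform and independent of the past. -/
lemma sum_mul_apply_numAbove (hx : x.Injective) (i : Fin n) {f : Arrangement n k → ℝ}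
    (hf : DependsOnOrder x (seen n k i) f) (G : ℕ → ℕ → ℝ) :
    ∑ σ, f σ * G (numAbove x (seen n k i) (Sum.inr i) σ) (samplesAbove x i σ) =
      ∑ σ, f σ * ((∑ r ∈ range (k + i + 1), G r (samplesAbove x i σ)) / (k + i + 1)) := by
  have h := sum_apply_numAbove (J := seen n k i) (a := Sum.inr i) hx (by simp)
    (F := fun r σ => f σ * G r (samplesAbove x i σ)) fun r σ τ hs => by
      simp only [hf σ τ hs, dependsOnOrder_samplesAbove x i σ τ hs]
  rw [h, card_seen i.isLt.le]
  push_cast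
  exact sum_congr rfl fun σ _ => by rw [← mul_sum, mul_div_assoc]

lemma sum_range_ite_le {N b : ℕ} (hb : b ≤ N) (g : ℕ → ℝ) (c : ℝ) :
    ∑ r ∈ range (N + 1), (if r ≤ b then g r else c) =
      ∑ r ∈ range (b + 1), g r + ((N : ℝ) - b) * c := by
  obtain ⟨d, rfl⟩ := Nat.exists_eq_add_of_le hb
  rw [show b + d + 1 = b + 1 + d by ring, sum_range_add]
  congr 1
  · exact sum_congr rfl fun r hr => if_pos (Nat.le_of_lt_succ (mem_range.1 hr))
  · rw [sum_congr rfl fun r _ => if_neg (by omega : ¬ b + 1 + r ≤ b)]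
    simp

open scoped Classical in
/-- The law of the state after the next arrival: the candidate is a record with `r` samples above
it with probability `1 / (k + i + 1)` for each `r ≤ b`, where `b` samples lie above the previous
candidates, and otherwise `b` does not change. -/
lemma sum_mul_step (hx : x.Injective) (i : Fin n) {f : Arrangement n k → ℝ}
    (hf : DependsOnOrder x (seen n k i) f) (g c : ℕ → ℝ) :
    ∑ σ, f σ * (if IsRecord x i σ then g (samplesAbove x (i.val + 1) σ)
        else c (samplesAbove x (i.val + 1) σ)) =
      ∑ σ, f σ * ((∑ r ∈ range (samplesAbove x i σ + 1), g r +
        ((k : ℝ) + i - samplesAbove x i σ) * c (samplesAbove x i σ)) / (k + i + 1)) := by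
  have h := sum_mul_apply_numAbove hx i hf fun r b => if r ≤ b then g r else c b
  have hL : ∀ σ, (if IsRecord x i σ then g (samplesAbove x (i.val + 1) σ)
      else c (samplesAbove x (i.val + 1) σ)) =
      if numAbove x (seen n k i) (Sum.inr i) σ ≤ samplesAbove x i σ
        then g (numAbove x (seen n k i) (Sum.inr i) σ) else c (samplesAbove x i σ) := by
    intro σ
    by_cases hr : IsRecord x i σ
    · rw [if_pos hr, if_pos ((isRecord_iff i).1 hr), samplesAbove_succ_of_isRecord i hr]
    · rw [if_neg hr, if_neg (mt (isRecord_iff i).2 hr), samplesAbove_succ_of_not_isRecord i hr]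
  rw [sum_congr rfl fun σ _ => congrArg (f σ * ·) (hL σ), h]
  refine sum_congr rfl fun σ _ => ?_
  rw [sum_range_ite_le ((samplesAbove_le i).trans (Nat.le_add_right k i))]
  push_cast
  rfl

end State

/-! ### Backward induction -/

/-- The probability that none of the `d` remaining candidates beats the best of the first `m`
candidates, if `b` of the `k` samples lie above the latter. -/
noncomputable def stopValue (k : ℕ) : ℕ → ℕ → ℕ → ℝ
  | 0, _, _ => 1
  | d + 1, m, b => ((k : ℝ) + m - b) * stopValue k d (m + 1) b / (k + m + 1)

/-- The probability of winning under optimal play if all of the first `m` candidates were passed,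
`d` candidates remain, and `b` of the `k` samples lie above the first `m` candidates. -/
noncomputable def contValue (k : ℕ) : ℕ → ℕ → ℕ → ℝ
  | 0, _, _ => 0
  | d + 1, m, b =>
    (∑ r ∈ range (b + 1), max (stopValue k d (m + 1) r) (contValue k d (m + 1) r) +
      ((k : ℝ) + m - b) * contValue k d (m + 1) b) / (k + m + 1)

lemma stopValue_nonneg {k b : ℕ} (hb : b ≤ k) (d m : ℕ) : 0 ≤ stopValue k d m b := by
  have hb' : (b : ℝ) ≤ k := by exact_mod_cast hb
  induction d generalizing m with
  | zero => exact zero_le_one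
  | succ d ih =>
    have := mul_nonneg (by linarith [m.cast_nonneg (α := ℝ)] : 0 ≤ (k : ℝ) + m - b) (ih (m + 1))
    simp only [stopValue]
    positivity

lemma contValue_nonneg {k b : ℕ} (hb : b ≤ k) (d m : ℕ) : 0 ≤ contValue k d m b := by
  have hb' : (b : ℝ) ≤ k := by exact_mod_cast hb
  induction d generalizing m with
  | zero => exact le_rfl
  | succ d ih =>
    have h1 := mul_nonneg (by linarith [m.cast_nonneg (α := ℝ)] : 0 ≤ (k : ℝ) + m - b)
      (ih (m + 1))
    have h2 : 0 ≤ ∑ r ∈ range (b + 1),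
        max (stopValue k d (m + 1) r) (contValue k d (m + 1) r) := sum_nonneg fun r hr =>
      le_max_of_le_left (stopValue_nonneg (by rw [mem_range] at hr; omega) _ _)
    simp only [contValue]
    positivity

/-- If passing is strictly better than stopping in one period, then it is so one period earlier with
the same `b`: with positive probability the next candidate is no record, which keeps `b`, and
otherwise stopping has lost. -/
lemma stopValue_lt_contValue {k b d m : ℕ} (hb : b ≤ k) (hm : 0 < m)
    (h : stopValue k d (m + 1) b < contValue k d (m + 1) b) :
    stopValue k (d + 1) m b < contValue k (d + 1) m b := by
  have hb' : (b : ℝ) ≤ k := by exact_mod_cast hb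
  have hm' : (0 : ℝ) < m := by exact_mod_cast hm
  have h1 := mul_lt_mul_of_pos_left h (by linarith : 0 < (k : ℝ) + m - b)
  have h2 : 0 ≤ ∑ r ∈ range (b + 1),
      max (stopValue k d (m + 1) r) (contValue k d (m + 1) r) := sum_nonneg fun r hr =>
    le_max_of_le_left (stopValue_nonneg (by rw [mem_range] at hr; omega) _ _)
  simp only [stopValue, contValue]
  exact div_lt_div_of_pos_right (by linarith) (by positivity)

/-- Stopping at candidate `i` is at least as good as passing, if `i` is a record with signal `s`. -/
def StopOptimal (n : ℕ) {k : ℕ} (s : Fin (k + 1)) (i : ℕ) : Prop :=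
  contValue k (n - (i + 1)) (i + 1) (k - s) ≤ stopValue k (n - (i + 1)) (i + 1) (k - s)

lemma StopOptimal.succ {n k : ℕ} {s : Fin (k + 1)} {i : ℕ} (hi : i + 1 < n)
    (h : StopOptimal n s i) : StopOptimal n s (i + 1) := by
  unfold StopOptimal at *
  contrapose! h
  rw [show n - (i + 1) = n - (i + 1 + 1) + 1 by omega]
  exact stopValue_lt_contValue (Nat.sub_le _ _) (Nat.succ_pos i) h

lemma StopOptimal.mono {n k : ℕ} {s : Fin (k + 1)} {i j : ℕ} (hij : i ≤ j) (hj : j < n)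
    (h : StopOptimal n s i) : StopOptimal n s j := by
  induction j, hij using Nat.le_induction with
  | base => exact h
  | succ j _ ih => exact (ih (by omega)).succ hj

/-- The periods where stopping at a record is optimal form an up-set for each signal. -/
lemma exists_threshold {n : ℕ} (hn : 1 ≤ n) (k : ℕ) :
    ∃ t : Fin (k + 1) → Fin n, ∀ s i, t s ≤ i ↔ StopOptimal n s i.val := by
  classical
  have hlast : ∀ s : Fin (k + 1), StopOptimal n s (n - 1) := fun s => by
    unfold StopOptimal
    rw [show n - (n - 1 + 1) = 0 by omega]
    exact zero_le_one
  have hex : ∀ s : Fin (k + 1), ∃ i, StopOptimal n s i := fun s => ⟨_, hlast s⟩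
  refine ⟨fun s => ⟨Nat.find (hex s), (Nat.find_min' _ (hlast s)).trans_lt (by omega)⟩,
    fun s i => ⟨fun h => (Nat.find_spec (hex s)).mono h i.isLt, fun h => Nat.find_min' _ h⟩⟩

/-! ### The value of a policy -/

section Policy

variable {n k : ℕ} {x : Fin (n + k) → ℝ}

open scoped Classical in
/-- `stopValue` is the conditional probability that no record follows. -/
lemma sum_mul_no_record (hx : x.Injective) (d : ℕ) {m : ℕ} (hd : m + d = n)
    {f : Arrangement n k → ℝ} (hf : DependsOnOrder x (seen n k m) f) :
    ∑ σ, f σ * (if ∀ i : Fin n, m ≤ i.val → ¬ IsRecord x i σ then 1 else 0) =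
      ∑ σ, f σ * stopValue k d m (samplesAbove x m σ) := by
  induction d generalizing m f with
  | zero =>
    refine sum_congr rfl fun σ _ => ?_
    rw [if_pos fun i hi => absurd i.isLt (by omega)]
    rfl
  | succ d ih =>
    let i : Fin n := ⟨m, by omega⟩
    have hstep := sum_mul_step hx i hf (fun _ => 0) (stopValue k d (m + 1))
    have hf' : DependsOnOrder x (seen n k (m + 1))
        fun σ => f σ * if IsRecord x i σ then 0 else 1 := fun σ τ hs => by
      simp only [hf σ τ (hs.mono (seen_subset (by omega))), dependsOnOrder_isRecord x i σ τ hs]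
    have hih := ih (by omega) hf'
    calc _ = ∑ σ, (f σ * if IsRecord x i σ then 0 else 1) *
          (if ∀ j : Fin n, m + 1 ≤ j.val → ¬ IsRecord x j σ then 1 else 0) := by
          refine sum_congr rfl fun σ _ => ?_
          have hiff : (∀ j : Fin n, m ≤ j.val → ¬ IsRecord x j σ) ↔
              ¬ IsRecord x i σ ∧ ∀ j : Fin n, m + 1 ≤ j.val → ¬ IsRecord x j σ := by
            refine ⟨fun h => ⟨h i le_rfl, fun j hj => h j (by omega)⟩, fun h j hj => ?_⟩
            rcases hj.eq_or_lt with he | hlt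
            · rw [show j = i from Fin.ext he.symm]; exact h.1
            · exact h.2 j hlt
          simp only [hiff]
          by_cases hr : IsRecord x i σ <;> simp [hr]
      _ = _ := by
          rw [hih]
          refine Eq.trans (sum_congr rfl fun σ _ => ?_) (hstep.trans (sum_congr rfl fun σ _ => ?_))
          · by_cases hr : IsRecord x i σ <;> simp [hr, i]
          · simp [stopValue, i]

/-- The best candidate is the last record. -/
lemma rank_eq_iff (hx : x.Injective) (σ : Arrangement n k) (i : Fin n) :
    rank x σ i = n ↔
      IsRecord x i σ ∧ ∀ j : Fin n, i.val + 1 ≤ j.val → ¬ IsRecord x j σ := by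
  have hall : rank x σ i = n ↔ ∀ j, value x σ j ≤ value x σ i := by
    unfold rank
    conv_lhs => rhs; rw [← card_fin n]
    rw [card_filter_eq_iff]
    simp
  rw [hall]
  refine ⟨fun h => ⟨fun j _ => h j, fun j hj hr => ?_⟩, fun ⟨hi, h⟩ => ?_⟩
  · have he := hx (le_antisymm (hr i (Fin.lt_def.2 hj)) (h j))
    have : i = j := by simpa using σ.injective he
    omega
  · -- the first best candidate is a record, so it does not come after `i`
    have hne : (univ : Finset (Fin n)).Nonempty := ⟨i, mem_univ i⟩
    obtain ⟨j, -, hj⟩ := exists_max_image univ (value x σ) hne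
    have hji : j ≤ i := by
      by_contra hlt
      exact h j (Fin.lt_def.1 (not_le.1 hlt)) fun l _ => hj l (mem_univ l)
    intro l
    rcases hji.eq_or_lt with rfl | hlt
    · exact hj l (mem_univ l)
    · exact (hj l (mem_univ l)).trans (hi j hlt)

/-- The probability that a policy passes on the first `m` candidates. -/
noncomputable def Policy.passProb (π : Policy n k) (x : Fin (n + k) → ℝ) (m : ℕ)
    (σ : Arrangement n k) : ℝ :=
  ∏ j : Fin n with j.val < m, (1 - π.stopProb j (history x σ j))

lemma Policy.passProb_nonneg (π : Policy n k) (m : ℕ) (σ : Arrangement n k) :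
    0 ≤ π.passProb x m σ :=
  prod_nonneg fun j _ => sub_nonneg.2 (π.le_one j _)

lemma Policy.passProb_succ (π : Policy n k) (i : Fin n) (σ : Arrangement n k) :
    π.passProb x (i.val + 1) σ = π.passProb x i σ * (1 - π.stopProb i (history x σ i)) := by
  have : univ.filter (fun j : Fin n => j.val < i.val + 1) =
      insert i (univ.filter fun j : Fin n => j.val < i.val) := by
    ext j
    simp only [mem_filter, mem_univ, true_and, mem_insert, Fin.ext_iff]
    omega
  unfold passProb
  rw [this, prod_insert (by simp), mul_comm]

lemma Policy.dependsOnOrder_passProb (π : Policy n k) (x : Fin (n + k) → ℝ) (m : ℕ) :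
    DependsOnOrder x (seen n k m) (π.passProb x m) := by
  intro σ τ h
  refine prod_congr rfl fun j hj => ?_
  have hjm : j.val + 1 ≤ m := (mem_filter.1 hj).2
  have hh : history x σ j = history x τ j :=
    dependsOnOrder_history x j σ τ (h.mono (seen_subset hjm))
  rw [hh]

open scoped Classical in
/-- The conditional probability of winning, given the information at the arrival of `i`, for the
policy `π` at `i` followed by optimal play. -/
noncomputable def Policy.stepValue (π : Policy n k) (x : Fin (n + k) → ℝ) (i : Fin n)
    (σ : Arrangement n k) : ℝ :=
  π.stopProb i (history x σ i) * (if IsRecord x i σ then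
      stopValue k (n - (i + 1)) (i + 1) (samplesAbove x (i.val + 1) σ) else 0) +
    (1 - π.stopProb i (history x σ i)) *
      contValue k (n - (i + 1)) (i + 1) (samplesAbove x (i.val + 1) σ)

open scoped Classical in
/-- The conditional probability of winning, given the information at the arrival of `i`, under
optimal play from `i` on. -/
noncomputable def optValue (x : Fin (n + k) → ℝ) (i : Fin n) (σ : Arrangement n k) : ℝ :=
  if IsRecord x i σ then
    max (stopValue k (n - (i + 1)) (i + 1) (samplesAbove x (i.val + 1) σ))
      (contValue k (n - (i + 1)) (i + 1) (samplesAbove x (i.val + 1) σ))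
  else contValue k (n - (i + 1)) (i + 1) (samplesAbove x (i.val + 1) σ)

lemma Policy.stepValue_le_optValue (π : Policy n k) (i : Fin n) (σ : Arrangement n k) :
    π.stepValue x i σ ≤ optValue x i σ := by
  have h0 := π.nonneg i (history x σ i)
  have h1 := sub_nonneg.2 (π.le_one i (history x σ i))
  unfold stepValue optValue
  split_ifs with hr
  · calc _ ≤ _ := add_le_add (mul_le_mul_of_nonneg_left (le_max_left _ _) h0)
          (mul_le_mul_of_nonneg_left (le_max_right _ _) h1)
      _ = _ := by ring
  · rw [mul_zero, zero_add]
    exact mul_le_of_le_one_left (contValue_nonneg (samplesAbove_le _) _ _) (by linarith)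

lemma sum_passProb_mul_contValue (hx : x.Injective) (π : Policy n k) (i : Fin n) :
    ∑ σ, π.passProb x i σ * contValue k (n - i) i (samplesAbove x i σ) =
      ∑ σ, π.passProb x i σ * optValue x i σ := by
  have h := sum_mul_step hx i (π.dependsOnOrder_passProb x i)
    (fun r => max (stopValue k (n - (i + 1)) (i + 1) r) (contValue k (n - (i + 1)) (i + 1) r))
    (contValue k (n - (i + 1)) (i + 1))
  unfold optValue
  rw [h]
  refine sum_congr rfl fun σ _ => ?_
  rw [show n - i.val = n - (i + 1) + 1 by omega]
  rfl

lemma sum_pickProb_add (hx : x.Injective) (π : Policy n k) (i : Fin n) :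
    ∑ σ, (if rank x σ i = n then π.pickProb x σ i else 0) +
      ∑ σ, π.passProb x (i.val + 1) σ *
        contValue k (n - (i + 1)) (i + 1) (samplesAbove x (i.val + 1) σ) =
      ∑ σ, π.passProb x i σ * π.stepValue x i σ := by
  classical
  have hf : DependsOnOrder x (seen n k (i.val + 1)) fun σ => π.passProb x i σ *
      π.stopProb i (history x σ i) * (if IsRecord x i σ then 1 else 0) := fun σ τ hs => by
    have h1 := π.dependsOnOrder_passProb x i σ τ (hs.mono (seen_subset (by omega)))
    have h2 : history x σ i = history x τ i := dependsOnOrder_history x i σ τ hs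
    have h3 := dependsOnOrder_isRecord x i σ τ hs
    simp only [h1, h2, h3]
  have h := sum_mul_no_record hx (n - (i + 1)) (by omega) hf
  have hL : ∑ σ, (if rank x σ i = n then π.pickProb x σ i else 0) = ∑ σ, π.passProb x i σ *
      π.stopProb i (history x σ i) * (if IsRecord x i σ then 1 else 0) *
      (if ∀ j : Fin n, i.val + 1 ≤ j.val → ¬ IsRecord x j σ then 1 else 0) := by
    refine sum_congr rfl fun σ _ => ?_
    simp only [rank_eq_iff hx, Policy.pickProb, Policy.passProb, Fin.lt_def]
    by_cases hr : IsRecord x i σ <;> simp [hr]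
  rw [hL, h, ← sum_add_distrib]
  refine sum_congr rfl fun σ _ => ?_
  rw [π.passProb_succ, Policy.stepValue]
  by_cases hr : IsRecord x i σ
  · simp only [hr, if_true]; ring
  · simp only [hr, if_false]; ring

/-- The number of arrangements times the loss of a policy against optimal play is the sum over the
periods of the losses in one step. -/
lemma sum_pickProb_eq (hx : x.Injective) (π : Policy n k) :
    ∑ σ : Arrangement n k, ∑ i : Fin n, (if rank x σ i = n then π.pickProb x σ i else 0) =
      ∑ _σ : Arrangement n k, contValue k n 0 k -
        ∑ i : Fin n, ∑ σ, π.passProb x i σ * (optValue x i σ - π.stepValue x i σ) := by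
  let Φ : ℕ → ℝ := fun m => ∑ σ, π.passProb x m σ * contValue k (n - m) m (samplesAbove x m σ)
  have hstep : ∀ i : Fin n, ∑ σ, (if rank x σ i = n then π.pickProb x σ i else 0) +
      ∑ σ, π.passProb x i σ * (optValue x i σ - π.stepValue x i σ) =
      Φ i - Φ (i.val + 1) := by
    intro i
    have h1 : Φ i = _ := sum_passProb_mul_contValue hx π i
    have h2 : _ + Φ (i.val + 1) = _ := sum_pickProb_add hx π i
    simp only [mul_sub, sum_sub_distrib]
    linarith
  have h0 : Φ 0 = ∑ _σ : Arrangement n k, contValue k n 0 k := by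
    simp only [Φ, Policy.passProb, samplesAbove_zero]
    simp
  have hn : Φ n = 0 := by simp [Φ, contValue]
  have htel : ∑ i : Fin n, (Φ i - Φ (i.val + 1)) = Φ 0 - Φ n := by
    rw [Fin.sum_univ_eq_sum_range (fun m => Φ m - Φ (m + 1)), sum_range_sub']
  rw [sum_comm, eq_sub_iff_add_eq, ← sum_add_distrib, sum_congr rfl fun i _ => hstep i, htel, hn,
    h0, sub_zero]

lemma bestSoFar_history_iff (σ : Arrangement n k) (i : Fin n) :
    (history x σ i).BestSoFar ↔ IsRecord x i σ := by
  refine ⟨fun h j hj => h ⟨j.val, by omega⟩, fun h a => ?_⟩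
  rcases (Fin.le_last a).eq_or_lt with rfl | hlt
  · exact le_rfl
  · exact h (Fin.castLE i.isLt a) hlt

/-- The signal of a record is determined by the number of samples above it. -/
lemma signal_of_isRecord (hx : x.Injective) {σ : Arrangement n k} {i : Fin n}
    (h : IsRecord x i σ) :
    k - ((history x σ i).signal (Fin.last i.val)).val = samplesAbove x (i.val + 1) σ := by
  have hs : samplesAbove x (i.val + 1) σ =
      #{b : Fin k | ¬ sampleValue x σ b < value x σ i} := by
    refine congrArg card (filter_congr fun b _ =>
      ⟨fun hb => (hb i (by omega)).not_gt, fun hb j hj => ?_⟩)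
    have hne : value x σ i ≠ sampleValue x σ b := fun he => by
      simpa using σ.injective (hx he)
    refine lt_of_le_of_lt ?_ (lt_of_le_of_ne (not_lt.1 hb) hne)
    rcases eq_or_ne j i with rfl | hji
    · exact le_rfl
    · exact h j (lt_of_le_of_ne (Fin.le_def.2 (by omega)) hji)
  have hsum := card_filter_add_card_filter_not (s := (univ : Finset (Fin k)))
    (fun b => sampleValue x σ b < value x σ i)
  rw [card_univ, Fintype.card_fin] at hsum
  rw [hs]
  exact (Nat.eq_sub_of_add_eq' hsum).symm

/-- A threshold policy whose thresholds cut out the optimal stopping periods loses nothing. -/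
lemma stepValue_thresholdPolicy (hx : x.Injective) {t : Fin (k + 1) → Fin n}
    (ht : ∀ s i, t s ≤ i ↔ StopOptimal n s i.val) (i : Fin n) (σ : Arrangement n k) :
    (thresholdPolicy t).stepValue x i σ = optValue x i σ := by
  unfold Policy.stepValue optValue thresholdPolicy
  by_cases hr : IsRecord x i σ
  · simp only [bestSoFar_history_iff, hr, true_and, if_true, ht, StopOptimal,
      signal_of_isRecord hx hr]
    split_ifs with h
    · rw [max_eq_left h]; ring
    · rw [max_eq_right (not_le.1 h).le]; ring
  · simp [bestSoFar_history_iff, hr]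

end Policy

end SecretarySamples

theorem mainTheorem6 (n k : ℕ) (hn : 1 ≤ n) :
    ∃ π : SecretarySamples.Policy n k, π.IsThreshold ∧ π.IsOptimal := by
  obtain ⟨t, ht⟩ := SecretarySamples.exists_threshold hn k
  refine ⟨SecretarySamples.thresholdPolicy t, ⟨t, rfl⟩, fun x hx π' => ?_⟩
  unfold SecretarySamples.Policy.winProb
  rw [Finset.expect_eq_sum_div_card, Finset.expect_eq_sum_div_card]
  refine div_le_div_of_nonneg_right ?_ (Nat.cast_nonneg _)
  rw [SecretarySamples.sum_pickProb_eq hx, SecretarySamples.sum_pickProb_eq hx]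
  refine sub_le_sub_left ?_ _
  refine Finset.sum_le_sum fun i _ => Finset.sum_le_sum fun σ _ => ?_
  rw [SecretarySamples.stepValue_thresholdPolicy hx ht, sub_self, mul_zero]
  exact mul_nonneg (π'.passProb_nonneg _ _) (sub_nonneg.2 (π'.stepValue_le_optValue i σ))
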